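/- Let $\mathscr{O}$ be a (symmetric, May-style) operad in simplicial sets and let $\mathcal{W}\subset \mathscr{O}(1)$ be a (simplicial) submonoid of the simplicial monoid of one-ary operations. The \emph{tree hammock localization} $L\mathscr{O}=L^{TH}_{\mathcal W}\mathscr{O}$ is the following operad in simplicial sets. For an operad $P$ in sets and a submonoid $W\subset P(1)$, a tree hammock of height $k$ and arity $n$ is a commutative diagram consisting of $k+1$ parallel copies (planes $0,\dots,k$) of a rooted planar tree with $n$ leaf nodes labelled $1,\dots,n$, glued from pieces $O_m\colon 1\to m$ ($m\ge 0$) and $W_1\colon 1\leftarrow 1$. In each plane, pieces $O_m$ are labelled by elements of $P(m)$ and pieces $W_1$ by elements of $W$; corresponding nodes in consecutive planes are joined by downward arrows labelled by elements of $W$, which are identities at the root and at the leaf nodes. Tree hammocks are taken up to reduction, i.e. up to composing adjacent pieces that point in the same direction and deleting columns $O_1$ or $W_1$ all of whose labels are the identity; moreover a piece labelled $c\sigma$ ($\sigma\in\Sigma_m$) in all planes, with trees glued to its inputs, is identified with the piece labelled $c$ with the correspondingly permuted trees. Operad composition is grafting, the symmetric groups act by relabelling leaf nodes, and faces and degeneracies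 delete or repeat planes. The $k$-simplices of $L\mathscr{O}(n)$ are the classes of tree hammocks of height $k$ and arity $n$ over the operad $\mathscr{O}_k$ of $k$-simplices of $\mathscr{O}$ with respect to $\mathcal{W}_k$ (that is, $L\mathscr{O}$ is the diagonal of the bisimplicial operad of tree hammocks). There is a canonical map of operads $\mathscr{O}\to L\mathscr{O}$ sending $c\in\mathscr{O}(n)$ to the tree with the single piece $O_n$ labelled $c$ in all planes. Let $Y$ be any $L\mathscr{O}$-algebra: a simplicial set with simplicial structure maps $\theta\colon L\mathscr{O}(n)\times Y^n\to Y$, $n\ge 0$, that are associative, unital and equivariant. (A base point of $Y$ compatible with a distinguished nullary operation may be present, but is not required.) \textbf{Proposition.} For every $w\in\mathcal{W}$ (a vertex), the action $\theta(w;-)\colon Y\to Y$ of the image of $w$ in $L\mathscr{O}(1)$ is a homotopy equivalence: there is a simplicial map $g\colon Y\to Y$ such that both composites of $g$ with $\theta(w;-)$ are homotopic to $\mathrm{id}_Y$, where two simplicial maps are homotopic if they are related by the equivalence relation generated by simplicial homotopies $Y\times\Delta[1]\to Y$. -/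

import Mathlib

open CategoryTheory Opposite

universe u v

/-! ## Operads in sets -/

/-- The bijection of input positions `(s, t) ↦ (σ s, t)`: the block permutation of `σ`. -/
def blockPerm {k k' : ℕ} (σ : Fin k ≃ Fin k') (j : Fin k' → ℕ) :
    Fin (∑ s, j (σ s)) ≃ Fin (∑ s, j s) :=
  finSigmaFinEquiv.symm.trans ((Equiv.sigmaCongrLeft (β := fun s => Fin (j s)) σ).trans
    finSigmaFinEquiv)

/-- The block sum `τ₁ ⊕ ⋯ ⊕ τ_k`. -/
def blockSum {k : ℕ} {i j : Fin k → ℕ} (τ : ∀ s, Fin (i s) ≃ Fin (j s)) :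
    Fin (∑ s, i s) ≃ Fin (∑ s, j s) :=
  finSigmaFinEquiv.symm.trans ((Equiv.sigmaCongrRight τ).trans finSigmaFinEquiv)

/-- The order preserving bijection `(s, 0) ↦ s`. -/
def collapseRight (k : ℕ) : Fin (∑ _s : Fin k, 1) ≃ Fin k :=
  finSigmaFinEquiv.symm.trans (Equiv.sigmaUnique (Fin k) fun _ => Fin 1)

/-- The order preserving bijection `(0, t) ↦ t`. -/
def collapseLeft (n : ℕ) : Fin (∑ _s : Fin 1, n) ≃ Fin n :=
  finSigmaFinEquiv.symm.trans (Equiv.uniqueSigma fun _ : Fin 1 => Fin n)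

/-- The order preserving rebracketing `((s, t), r) ↦ (s, (t, r))`. -/
def rebracket {k : ℕ} (j : Fin k → ℕ) (i : Fin (∑ s, j s) → ℕ) :
    Fin (∑ x, i x) ≃ Fin (∑ s, ∑ t, i (finSigmaFinEquiv ⟨s, t⟩)) :=
  finSigmaFinEquiv.symm.trans <|
    (Equiv.sigmaCongrLeft (β := fun x => Fin (i x)) finSigmaFinEquiv).symm.trans <|
      (Equiv.sigmaAssoc fun s t => Fin (i (finSigmaFinEquiv ⟨s, t⟩))).trans <|
        (Equiv.sigmaCongrRight fun _ => finSigmaFinEquiv).trans finSigmaFinEquiv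

lemma blockPerm_apply {k k' : ℕ} (σ : Fin k ≃ Fin k') (j : Fin k' → ℕ) (s : Fin k)
    (t : Fin (j (σ s))) :
    blockPerm σ j (finSigmaFinEquiv ⟨s, t⟩) = finSigmaFinEquiv ⟨σ s, t⟩ := by
  simp [blockPerm]

lemma blockSum_apply {k : ℕ} {i j : Fin k → ℕ} (τ : ∀ s, Fin (i s) ≃ Fin (j s)) (s : Fin k)
    (t : Fin (i s)) :
    blockSum τ (finSigmaFinEquiv ⟨s, t⟩) = finSigmaFinEquiv ⟨s, τ s t⟩ := by
  simp [blockSum]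

lemma rebracket_apply {k : ℕ} (j : Fin k → ℕ) (i : Fin (∑ s, j s) → ℕ) (s : Fin k)
    (t : Fin (j s)) (r : Fin (i (finSigmaFinEquiv ⟨s, t⟩))) :
    rebracket j i (finSigmaFinEquiv ⟨finSigmaFinEquiv ⟨s, t⟩, r⟩) =
      finSigmaFinEquiv ⟨s, finSigmaFinEquiv ⟨t, r⟩⟩ := by
  have h : (Equiv.sigmaCongrLeft (β := fun x => Fin (i x)) finSigmaFinEquiv).symm
      ⟨finSigmaFinEquiv ⟨s, t⟩, r⟩ = ⟨⟨s, t⟩, r⟩ := by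
    rw [Equiv.symm_apply_eq]
    rfl
  simp only [rebracket, Equiv.trans_apply, Equiv.symm_apply_apply, h]
  rfl

/-- A (symmetric, May style) operad in sets.  A bijection `Fin n ≃ Fin m` exists only for `n = m`,
so `act` is precisely a right action of every symmetric group `Σ_n` on `Op n` (written so that it
also transports along equalities of arities).  In the two unit laws and in associativity the
bijection is the order preserving one, i.e. the transport along the equality of the arities. -/
structure SetOperad where
  Op : ℕ → Type u
  one : Op 1
  act : ∀ {m n : ℕ}, Op m → (Fin n ≃ Fin m) → Op n
  comp : ∀ {k : ℕ} (_ : Op k) {j : Fin k → ℕ} (_ : ∀ s, Op (j s)), Op (∑ s, j s)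
  act_refl : ∀ {n : ℕ} (c : Op n), act c (Equiv.refl _) = c
  act_act : ∀ {l m n : ℕ} (c : Op l) (σ : Fin m ≃ Fin l) (τ : Fin n ≃ Fin m),
    act (act c σ) τ = act c (τ.trans σ)
  one_comp : ∀ {n : ℕ} (c : Op n), comp one (fun _ => c) = act c (collapseLeft n)
  comp_one : ∀ {n : ℕ} (c : Op n), comp c (fun _ => one) = act c (collapseRight n)
  assoc : ∀ {k : ℕ} (c : Op k) {j : Fin k → ℕ} (d : ∀ s, Op (j s))
    {i : Fin (∑ s, j s) → ℕ} (e : ∀ x, Op (i x)),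
    comp (comp c d) e =
      act (comp c fun s => comp (d s) fun t => e (finSigmaFinEquiv ⟨s, t⟩)) (rebracket j i)
  act_comp : ∀ {k k' : ℕ} (c : Op k') (σ : Fin k ≃ Fin k') {j : Fin k' → ℕ} (d : ∀ s, Op (j s)),
    comp (act c σ) (fun s => d (σ s)) = act (comp c d) (blockPerm σ j)
  comp_act : ∀ {k : ℕ} (c : Op k) {i j : Fin k → ℕ} (d : ∀ s, Op (j s))
    (τ : ∀ s, Fin (i s) ≃ Fin (j s)),
    comp c (fun s => act (d s) (τ s)) = act (comp c d) (blockSum τ)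

namespace SetOperad

/-- Maps of operads in sets. -/
@[ext]
structure Hom (P Q : SetOperad.{u}) where
  app : ∀ {n : ℕ}, P.Op n → Q.Op n
  map_one : app P.one = Q.one
  map_act : ∀ {m n : ℕ} (c : P.Op m) (σ : Fin n ≃ Fin m), app (P.act c σ) = Q.act (app c) σ
  map_comp : ∀ {k : ℕ} (c : P.Op k) {j : Fin k → ℕ} (d : ∀ s, P.Op (j s)),
    app (P.comp c d) = Q.comp (app c) (fun s => app (d s))

instance : Category SetOperad.{u} where
  Hom := Hom
  id P := ⟨fun c => c, rfl, fun _ _ => rfl, fun _ _ _ => rfl⟩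
  comp F G := ⟨fun c => G.app (F.app c), by rw [F.map_one, G.map_one],
    fun _ _ => by rw [F.map_act, G.map_act], fun _ _ _ => by rw [F.map_comp, G.map_comp]⟩

@[simp] lemma id_app (P : SetOperad.{u}) {n : ℕ} (c : P.Op n) : Hom.app (𝟙 P) c = c := rfl

@[simp] lemma comp_app {P Q R : SetOperad.{u}} (F : P ⟶ Q) (G : Q ⟶ R) {n : ℕ} (c : P.Op n) :
    Hom.app (F ≫ G) c = Hom.app G (Hom.app F c) := rfl

variable (P : SetOperad.{u})

/-- `γ(c; f₁, …, fₙ)` for one-ary `f_s`, as an `n`-ary operation. -/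
def pre {n : ℕ} (c : P.Op n) (f : Fin n → P.Op 1) : P.Op n :=
  P.act (P.comp c f) (collapseRight n).symm

/-- `γ(f; c)` for one-ary `f`, as an `n`-ary operation. -/
def post {n : ℕ} (f : P.Op 1) (c : P.Op n) : P.Op n :=
  P.act (P.comp f fun _ => c) (collapseLeft n).symm

lemma pre_one {n : ℕ} (c : P.Op n) : P.pre c (fun _ => P.one) = c := by
  rw [pre, comp_one, act_act, Equiv.symm_trans_self, act_refl]

lemma one_post {n : ℕ} (c : P.Op n) : P.post P.one c = c := by
  rw [post, one_comp, act_act, Equiv.symm_trans_self, act_refl]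

variable {P}

lemma map_pre {Q : SetOperad.{u}} (F : P ⟶ Q) {n : ℕ} (c : P.Op n) (f : Fin n → P.Op 1) :
    F.app (P.pre c f) = Q.pre (F.app c) fun s => F.app (f s) := by
  rw [pre, pre, F.map_act, F.map_comp]

lemma map_post {Q : SetOperad.{u}} (F : P ⟶ Q) {n : ℕ} (f : P.Op 1) (c : P.Op n) :
    F.app (P.post f c) = Q.post (F.app f) (F.app c) := by
  rw [post, post, F.map_act, F.map_comp]

variable (P)

/-- A submonoid of the monoid `P(1)` of one-ary operations, with product `γ(f; g)`. -/
structure UnarySubmonoid where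
  carrier : Set (P.Op 1)
  one_mem : P.one ∈ carrier
  mul_mem : ∀ {f g : P.Op 1}, f ∈ carrier → g ∈ carrier → P.post f g ∈ carrier

end SetOperad

/-! ## HTree hammocks over an operad in sets -/

namespace TreeHammock

open SetOperad

/-- The column of vertical arrows at one node: for planes `i ≤ j` the composite of the arrows
from plane `i` down to plane `j`, an element of `W`.  For planes indexed by `{0, …, k}` this is
the same as `k` consecutive arrows. -/
@[ext]
structure Chain (P : SetOperad.{u}) (W : P.UnarySubmonoid) (ι : Type) [Preorder ι] where
  hom : ∀ {i j : ι}, i ≤ j → P.Op 1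
  mem : ∀ {i j : ι} (h : i ≤ j), hom h ∈ W.carrier
  hom_refl : ∀ i : ι, hom (le_refl i) = P.one
  hom_trans : ∀ {i j l : ι} (h : i ≤ j) (h' : j ≤ l), P.post (hom h) (hom h') = hom (h.trans h')

section

variable {P : SetOperad.{u}} {W : P.UnarySubmonoid} {ι : Type} [Preorder ι]

/-- The column in which all vertical arrows are identities. -/
def Chain.one (P : SetOperad.{u}) (W : P.UnarySubmonoid) (ι : Type) [Preorder ι] :
    Chain P W ι where
  hom _ := P.one
  mem _ := W.one_mem
  hom_refl _ := rfl
  hom_trans _ _ := P.one_post _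

variable (P W ι) in
/-- Not necessarily reduced diagrams of tree shape with leaf nodes labelled by elements of `X` and
planes indexed by `ι`.
* `leaf x` is the tree with one node, labelled `x`;
* `fwd c u t` has the atomic piece `O_n : 1 → n` at its root, labelled `c i` in plane `i`, with the
  tree `t s` glued to its `s`-th leaf node, and `u s` is the column of vertical arrows there;
* `back w u t` has the atomic piece `W_1 : 1 ← 1` at its root, labelled `w i` in plane `i`, with the
  tree `t` glued to its leaf node, and `u` is the column of vertical arrows there.
The column of vertical arrows at the root is not recorded. -/
inductive HTree (X : Type) : Type u
  | leaf (x : X) : HTree X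
  | fwd {n : ℕ} (c : ι → P.Op n) (u : Fin n → Chain P W ι) (t : Fin n → HTree X) : HTree X
  | back (w : ι → P.Op 1) (u : Chain P W ι) (t : HTree X) : HTree X

/-- Commutativity of the squares at a piece `O_n : 1 → n`, with column `v` at the root and
columns `u s` at the leaf nodes. -/
def IsFwd {n : ℕ} (v : Chain P W ι) (c : ι → P.Op n) (u : Fin n → Chain P W ι) : Prop :=
  ∀ (i j : ι) (h : i ≤ j), P.pre (c i) (fun s => (u s).hom h) = P.post (v.hom h) (c j)

/-- A piece `W_1 : 1 ← 1` with labels in `W`, and commutativity of the squares at it, with column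
`v` at the root and column `u` at the leaf node. -/
def IsBack (v : Chain P W ι) (w : ι → P.Op 1) (u : Chain P W ι) : Prop :=
  (∀ i, w i ∈ W.carrier) ∧
    ∀ (i j : ι) (h : i ≤ j), P.post (w i) (v.hom h) = P.post (u.hom h) (w j)

namespace HTree

variable {X Y Z : Type}

/-- `WF v t`: with `v` as column of vertical arrows at the root, the diagram `t` commutes, its
labels lie where they should, and the vertical arrows at all the leaf nodes are identities. -/
def WF : Chain P W ι → HTree P W ι X → Prop
  | v, leaf _ => v = Chain.one P W ι
  | v, fwd c u t => IsFwd v c u ∧ ∀ s, WF (u s) (t s)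
  | v, back w u t => IsBack v w u ∧ WF u t

/-- Grafting: the tree `f x` is glued to every leaf node with label `x`. -/
def bind : HTree P W ι X → (X → HTree P W ι Y) → HTree P W ι Y
  | leaf x, f => f x
  | fwd c u t, f => fwd c u fun s => bind (t s) f
  | back w u t, f => back w u (bind t f)

/-- Relabelling of the leaf nodes. -/
def relabel (g : X → Y) (t : HTree P W ι X) : HTree P W ι Y := t.bind fun x => leaf (g x)

/-- The number of leaf nodes with label `x`. -/
def occ [DecidableEq X] (x : X) : HTree P W ι X → ℕ
  | leaf y => if y = x then 1 else 0
  | fwd _ _ t => ∑ s, occ x (t s)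
  | back _ _ t => occ x t

/-- Equality up to reduction of tree hammocks with column `v` at the root: the equivalence relation
generated, inside arbitrary larger trees, by
* `fwd_one`, `back_one`: deleting a piece `O_1` or `W_1` labelled by the identity in every plane;
* `fwd_comp`, `back_comp`: composing adjacent pieces that point in the same direction;
* `fwd_act`: an operation `cσ` with trees glued to its inputs is the operation `c` with the
  accordingly permuted trees glued to its inputs. -/
inductive Rel : Chain P W ι → HTree P W ι X → HTree P W ι X → Prop
  | refl {v t} : WF v t → Rel v t t
  | symm {v t t'} : Rel v t t' → Rel v t' t
  | trans {v t t' t''} : Rel v t t' → Rel v t' t'' → Rel v t t''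
  | fwd_congr {v} {n : ℕ} {c : ι → P.Op n} {u t t'} : IsFwd v c u →
      (∀ s, Rel (u s) (t s) (t' s)) → Rel v (fwd c u t) (fwd c u t')
  | back_congr {v w u t t'} : IsBack v w u → Rel u t t' → Rel v (back w u t) (back w u t')
  | fwd_one {v t} : WF v t →
      Rel v (fwd (fun _ => P.one) (fun _ : Fin 1 => v) fun _ => t) t
  | back_one {v t} : WF v t → Rel v (back (fun _ => P.one) v t) t
  | fwd_comp {v} {n : ℕ} {j : Fin n → ℕ} {c : ι → P.Op n} {u} {d : ∀ s, ι → P.Op (j s)}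
      {u' : ∀ s, Fin (j s) → Chain P W ι} {t : ∀ s, Fin (j s) → HTree P W ι X} :
      IsFwd v c u → (∀ s, IsFwd (u s) (d s) (u' s)) → (∀ s r, WF (u' s r) (t s r)) →
      Rel v (fwd c u fun s => fwd (d s) (u' s) (t s))
        (fwd (fun i => P.comp (c i) fun s => d s i)
          (fun x => u' (finSigmaFinEquiv.symm x).1 (finSigmaFinEquiv.symm x).2)
          (fun x => t (finSigmaFinEquiv.symm x).1 (finSigmaFinEquiv.symm x).2))
  | back_comp {v w u w' u' t} : IsBack v w u → IsBack u w' u' → WF u' t →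
      Rel v (back w u (back w' u' t)) (back (fun i => P.post (w' i) (w i)) u' t)
  | fwd_act {v} {m n : ℕ} {c : ι → P.Op m} {u : Fin m → Chain P W ι}
      {t : Fin m → HTree P W ι X} (σ : Fin n ≃ Fin m) : IsFwd v c u → (∀ s, WF (u s) (t s)) →
      Rel v (fwd (fun i => P.act (c i) σ) (fun s => u (σ s)) fun s => t (σ s)) (fwd c u t)

lemma bind_bind (t : HTree P W ι X) (f : X → HTree P W ι Y) (g : Y → HTree P W ι Z) :
    (t.bind f).bind g = t.bind fun x => (f x).bind g := by
  induction t with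
  | leaf x => rfl
  | fwd c u t ih => simp only [bind, ih]
  | back w u t ih => simp only [bind, ih]

lemma bind_leaf (t : HTree P W ι X) : t.bind leaf = t := by
  induction t with
  | leaf x => rfl
  | fwd c u t ih => simp only [bind, ih]
  | back w u t ih => simp only [bind, ih]

lemma WF.bind {v : Chain P W ι} {t : HTree P W ι X} {f : X → HTree P W ι Y}
    (ht : WF v t) (hf : ∀ x, WF (Chain.one P W ι) (f x)) : WF v (t.bind f) := by
  induction t generalizing v with
  | leaf x => cases ht; exact hf x
  | fwd c u t ih => exact ⟨ht.1, fun s => ih s (ht.2 s)⟩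
  | back w u t ih => exact ⟨ht.1, ih ht.2⟩

lemma WF.relabel {v : Chain P W ι} {t : HTree P W ι X} (g : X → Y) (ht : WF v t) :
    WF v (t.relabel g) := ht.bind fun _ => rfl

lemma Rel.bind {v : Chain P W ι} {t t' : HTree P W ι X} {f : X → HTree P W ι Y}
    (ht : Rel v t t') (hf : ∀ x, WF (Chain.one P W ι) (f x)) :
    Rel v (t.bind f) (t'.bind f) := by
  induction ht with
  | refl h => exact .refl (h.bind hf)
  | symm _ ih => exact ih.symm
  | trans _ _ ih ih' => exact ih.trans ih'
  | fwd_congr h _ ih => exact .fwd_congr h ih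
  | back_congr h _ ih => exact .back_congr h ih
  | fwd_one h => exact .fwd_one (h.bind hf)
  | back_one h => exact .back_one (h.bind hf)
  | fwd_comp h h' h'' => exact .fwd_comp h h' fun s r => (h'' s r).bind hf
  | back_comp h h' h'' => exact .back_comp h h' (h''.bind hf)
  | fwd_act σ h h' =>
    exact .fwd_act (t := fun s => (_ : HTree P W ι X).bind f) σ h fun s => (h' s).bind hf

lemma Rel.bind_right {v : Chain P W ι} {t : HTree P W ι X} {f f' : X → HTree P W ι Y}
    (ht : WF v t) (hf : ∀ x, Rel (Chain.one P W ι) (f x) (f' x)) :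
    Rel v (t.bind f) (t.bind f') := by
  induction t generalizing v with
  | leaf x => cases ht; exact hf x
  | fwd c u t ih => exact .fwd_congr ht.1 fun s => ih s (ht.2 s)
  | back w u t ih => exact .back_congr ht.1 (ih ht.2)

lemma occ_bind [Fintype X] [DecidableEq X] [DecidableEq Y] (y : Y) (t : HTree P W ι X)
    (f : X → HTree P W ι Y) : (t.bind f).occ y = ∑ x, t.occ x * (f x).occ y := by
  induction t with
  | leaf x => simp [bind, occ]
  | fwd c u t ih =>
    simp only [bind, occ, ih, Finset.sum_mul]
    exact Finset.sum_comm
  | back w u t ih => simpa only [bind, occ] using ih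

lemma relabel_relabel (t : HTree P W ι X) (g : X → Y) (h : Y → Z) :
    (t.relabel g).relabel h = t.relabel (h ∘ g) := bind_bind _ _ _

lemma relabel_bind (t : HTree P W ι X) (g : X → Y) (f : Y → HTree P W ι Z) :
    (t.relabel g).bind f = t.bind (f ∘ g) := bind_bind _ _ _

lemma occ_relabel [Fintype X] [DecidableEq X] [DecidableEq Y] (y : Y) (t : HTree P W ι X)
    (g : X → Y) : (t.relabel g).occ y = ∑ x, if g x = y then t.occ x else 0 := by
  rw [relabel, occ_bind]
  exact Finset.sum_congr rfl fun x _ => by simp [occ]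

end HTree

/-! ### Base change -/

variable {Q : SetOperad.{u}} {V : Q.UnarySubmonoid} {κ : Type} [Preorder κ] {X Y : Type}

/-- Base change of columns along a map of pairs `(P, W) → (Q, V)` and an order preserving map `φ`
of the index sets of the planes: plane `i` of the result is plane `φ i` of the given diagram.
(Leaving out a plane composes adjacent vertical arrows; repeating a plane inserts identities.) -/
def Chain.map (F : P ⟶ Q) (hF : ∀ f ∈ W.carrier, F.app f ∈ V.carrier) (φ : κ →o ι)
    (v : Chain P W ι) : Chain Q V κ where
  hom h := F.app (v.hom (φ.monotone h))
  mem h := hF _ (v.mem _)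
  hom_refl i := by rw [← F.map_one, ← v.hom_refl (φ i)]
  hom_trans h h' := by rw [← map_post, v.hom_trans]

/-- Base change of diagrams. -/
def HTree.map (F : P ⟶ Q) (hF : ∀ f ∈ W.carrier, F.app f ∈ V.carrier) (φ : κ →o ι) :
    HTree P W ι X → HTree Q V κ X
  | leaf x => leaf x
  | fwd c u t => fwd (fun i => F.app (c (φ i))) (fun s => (u s).map F hF φ)
      fun s => HTree.map F hF φ (t s)
  | back w u t => back (fun i => F.app (w (φ i))) (u.map F hF φ) (HTree.map F hF φ t)

section

variable (F : P ⟶ Q) (hF : ∀ f ∈ W.carrier, F.app f ∈ V.carrier) (φ : κ →o ι)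

lemma Chain.map_one : (Chain.one P W ι).map F hF φ = Chain.one Q V κ := by
  ext i j h
  exact F.map_one

lemma HTree.map_bind (t : HTree P W ι X) (f : X → HTree P W ι Y) :
    (t.bind f).map F hF φ = (t.map F hF φ).bind fun x => (f x).map F hF φ := by
  induction t with
  | leaf x => rfl
  | fwd c u t ih => simp only [HTree.bind, HTree.map, ih]
  | back w u t ih => simp only [HTree.bind, HTree.map, ih]

lemma HTree.map_relabel (t : HTree P W ι X) (g : X → Y) :
    (t.relabel g).map F hF φ = (t.map F hF φ).relabel g := HTree.map_bind F hF φ t _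

lemma HTree.occ_map [DecidableEq X] (x : X) (t : HTree P W ι X) :
    (t.map F hF φ).occ x = t.occ x := by
  induction t with
  | leaf x => rfl
  | fwd c u t ih => simp only [HTree.occ, HTree.map, ih]
  | back w u t ih => simp only [HTree.occ, HTree.map, ih]

variable {F hF φ}

lemma IsFwd.map {n : ℕ} {v : Chain P W ι} {c : ι → P.Op n} {u : Fin n → Chain P W ι}
    (h : IsFwd v c u) :
    IsFwd (v.map F hF φ) (fun i => F.app (c (φ i))) fun s => (u s).map F hF φ := fun i j hij => by
  have := congrArg F.app (h _ _ (φ.monotone hij))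
  rwa [map_pre, map_post] at this

lemma IsBack.map {v u : Chain P W ι} {w : ι → P.Op 1} (h : IsBack v w u) :
    IsBack (v.map F hF φ) (fun i => F.app (w (φ i))) (u.map F hF φ) :=
  ⟨fun i => hF _ (h.1 _), fun i j hij => by
    have := congrArg F.app (h.2 _ _ (φ.monotone hij))
    rwa [map_post, map_post] at this⟩

lemma HTree.WF.map {v : Chain P W ι} {t : HTree P W ι X} (ht : t.WF v) :
    (t.map F hF φ).WF (v.map F hF φ) := by
  induction t generalizing v with
  | leaf x => cases ht; exact Chain.map_one F hF φ
  | fwd c u t ih => exact ⟨ht.1.map, fun s => ih s (ht.2 s)⟩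
  | back w u t ih => exact ⟨ht.1.map, ih ht.2⟩

lemma HTree.Rel.map {v : Chain P W ι} {t t' : HTree P W ι X} (h : HTree.Rel v t t') :
    HTree.Rel (v.map F hF φ) (t.map F hF φ) (t'.map F hF φ) := by
  induction h with
  | refl h => exact .refl h.map
  | symm _ ih => exact ih.symm
  | trans _ _ ih ih' => exact ih.trans ih'
  | fwd_congr h _ ih => exact .fwd_congr h.map ih
  | back_congr h _ ih => exact .back_congr h.map ih
  | fwd_one h => simpa only [HTree.map, F.map_one] using HTree.Rel.fwd_one h.map
  | back_one h => simpa only [HTree.map, F.map_one] using HTree.Rel.back_one h.map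
  | fwd_comp h h' h'' =>
    simpa only [HTree.map, F.map_comp] using
      HTree.Rel.fwd_comp h.map (fun s => (h' s).map) fun s r => (h'' s r).map
  | back_comp h h' h'' =>
    simpa only [HTree.map, map_post] using HTree.Rel.back_comp h.map h'.map h''.map
  | fwd_act σ h h' =>
    simpa only [HTree.map, F.map_act] using
      HTree.Rel.fwd_act (t := fun s => HTree.map F hF φ _) σ h.map fun s => (h' s).map

end

lemma HTree.map_id {F : P ⟶ P} (h : F = 𝟙 P) (hF : ∀ f ∈ W.carrier, F.app f ∈ W.carrier)
    (t : HTree P W ι X) : t.map F hF OrderHom.id = t := by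
  subst h
  induction t with
  | leaf x => rfl
  | fwd c u t ih => simp only [HTree.map, ih]; rfl
  | back w u t ih => simp only [HTree.map, ih]; rfl

lemma HTree.map_map {R : SetOperad.{u}} {U : R.UnarySubmonoid} {μ : Type} [Preorder μ]
    {F : P ⟶ Q} {G : Q ⟶ R} {H : P ⟶ R} (h : H = F ≫ G)
    (hF : ∀ f ∈ W.carrier, F.app f ∈ V.carrier) (φ : κ →o ι)
    (hG : ∀ f ∈ V.carrier, G.app f ∈ U.carrier) (ψ : μ →o κ)
    (hH : ∀ f ∈ W.carrier, H.app f ∈ U.carrier) (t : HTree P W ι X) :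
    t.map H hH (φ.comp ψ) = (t.map F hF φ).map G hG ψ := by
  subst h
  induction t with
  | leaf x => rfl
  | fwd c u t ih => simp only [HTree.map, ih]; rfl
  | back w u t ih => simp only [HTree.map, ih]; rfl

/-! ### The operad of tree hammocks with planes indexed by `ι` -/

variable (P W ι) in
/-- Tree hammocks of a type in `𝕋(n)`: the vertical arrows at the root node and the leaf nodes are
identities and the `n` labelled leaf nodes are labelled `1, …, n` in some order (here `0, …, n-1`).
Pieces `O_0 : 1 → 0` are ends of the tree without label.  As in the hammock localization of a
category, the end points of a hammock are fixed (this is what makes grafting possible). -/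
def Diagram (n : ℕ) : Type u :=
  {t : HTree P W ι (Fin n) // t.WF (Chain.one P W ι) ∧ ∀ x, t.occ x = 1}

namespace Diagram

instance setoid (n : ℕ) : Setoid (Diagram P W ι n) where
  r t t' := HTree.Rel (Chain.one P W ι) t.1 t'.1
  iseqv := ⟨fun t => .refl t.2.1, .symm, .trans⟩

/-- The tree with one node. -/
def one : Diagram P W ι 1 := ⟨.leaf 0, rfl, fun x => by simp [HTree.occ, Subsingleton.elim x 0]⟩

/-- Relabelling the leaf nodes. -/
def act {m n : ℕ} (t : Diagram P W ι m) (σ : Fin n ≃ Fin m) : Diagram P W ι n :=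
  ⟨t.1.relabel σ.symm, t.2.1.relabel _, fun x => by
    rw [HTree.occ_relabel]
    simp [t.2.2, Equiv.symm_apply_eq]⟩

/-- Grafting the root node of `d s` onto the leaf node of `t` labelled `s`, and relabelling. -/
def comp {k : ℕ} (t : Diagram P W ι k) {j : Fin k → ℕ} (d : ∀ s, Diagram P W ι (j s)) :
    Diagram P W ι (∑ s, j s) :=
  ⟨t.1.bind fun s => (d s).1.relabel fun r => finSigmaFinEquiv ⟨s, r⟩,
    t.2.1.bind fun s => (d s).2.1.relabel _, fun x => by
      obtain ⟨y, rfl⟩ := finSigmaFinEquiv.surjective x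
      simp only [HTree.occ_bind, HTree.occ_relabel, t.2.2, (d _).2.2, one_mul,
        EmbeddingLike.apply_eq_iff_eq]
      rw [← Fintype.sum_sigma' (f := fun s r => if (⟨s, r⟩ : Σ s, Fin (j s)) = y then 1 else 0)]
      simp⟩

/-- Base change. -/
def map {n : ℕ} (F : P ⟶ Q) (hF : ∀ f ∈ W.carrier, F.app f ∈ V.carrier) (φ : κ →o ι)
    (t : Diagram P W ι n) : Diagram Q V κ n :=
  ⟨t.1.map F hF φ, by simpa only [Chain.map_one] using t.2.1.map (F := F) (hF := hF) (φ := φ),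
    fun x => by rw [HTree.occ_map, t.2.2]⟩

/-- The tree with one atomic piece `O_n : 1 → n`, labelled `c` in every plane. -/
def corolla {n : ℕ} (c : P.Op n) : Diagram P W ι n :=
  ⟨.fwd (fun _ => c) (fun _ => Chain.one P W ι) .leaf,
    ⟨fun _ _ _ => (P.pre_one c).trans (P.one_post c).symm, fun _ => rfl⟩, fun x => by
      simp [HTree.occ]⟩

lemma act_equiv {m n : ℕ} {t t' : Diagram P W ι m} (h : t ≈ t') (σ : Fin n ≃ Fin m) :
    act t σ ≈ act t' σ := HTree.Rel.bind h fun _ => rfl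

lemma comp_equiv {k : ℕ} {t t' : Diagram P W ι k} (h : t ≈ t') {j : Fin k → ℕ}
    {d d' : ∀ s, Diagram P W ι (j s)} (h' : ∀ s, d s ≈ d' s) : comp t d ≈ comp t' d' :=
  (HTree.Rel.bind h fun s => (d s).2.1.relabel _).trans
    (HTree.Rel.bind_right t'.2.1 fun s => HTree.Rel.bind (h' s) fun _ => rfl)

lemma map_equiv {n : ℕ} (F : P ⟶ Q) (hF : ∀ f ∈ W.carrier, F.app f ∈ V.carrier) (φ : κ →o ι)
    {t t' : Diagram P W ι n} (h : t ≈ t') : map F hF φ t ≈ map F hF φ t' := by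
  have := HTree.Rel.map (F := F) (hF := hF) (φ := φ) h
  rwa [Chain.map_one] at this

end Diagram

variable (P W ι) in
/-- Tree hammocks up to reduction: every class is that of a reduced tree hammock, in which adjacent
pieces point in different directions and no column `O_1` or `W_1` consists of identities; two tree
hammocks are identified when they reduce to the same one. -/
def HammockOp (n : ℕ) : Type u := Quotient (Diagram.setoid (P := P) (W := W) (ι := ι) n)

namespace HammockOp

def mk {n : ℕ} (t : Diagram P W ι n) : HammockOp P W ι n := Quotient.mk _ t

def act {m n : ℕ} (q : HammockOp P W ι m) (σ : Fin n ≃ Fin m) : HammockOp P W ι n :=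
  Quotient.map (fun t => t.act σ) (fun _ _ h => Diagram.act_equiv h σ) q

noncomputable def comp {k : ℕ} (q : HammockOp P W ι k) {j : Fin k → ℕ}
    (r : ∀ s, HammockOp P W ι (j s)) : HammockOp P W ι (∑ s, j s) :=
  mk (q.out.comp fun s => (r s).out)

def map {n : ℕ} (F : P ⟶ Q) (hF : ∀ f ∈ W.carrier, F.app f ∈ V.carrier) (φ : κ →o ι)
    (q : HammockOp P W ι n) : HammockOp Q V κ n :=
  Quotient.map (Diagram.map F hF φ) (fun _ _ h => Diagram.map_equiv F hF φ h) q

lemma mk_surjective {n : ℕ} (q : HammockOp P W ι n) : ∃ t, mk t = q := Quotient.exists_rep q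

lemma act_mk {m n : ℕ} (t : Diagram P W ι m) (σ : Fin n ≃ Fin m) :
    act (mk t) σ = mk (t.act σ) := rfl

lemma map_mk {n : ℕ} (F : P ⟶ Q) (hF : ∀ f ∈ W.carrier, F.app f ∈ V.carrier) (φ : κ →o ι)
    (t : Diagram P W ι n) : map F hF φ (mk t) = mk (t.map F hF φ) := rfl

lemma comp_mk {k : ℕ} (t : Diagram P W ι k) {j : Fin k → ℕ} (d : ∀ s, Diagram P W ι (j s)) :
    comp (mk t) (fun s => mk (d s)) = mk (t.comp d) :=
  Quotient.sound (Diagram.comp_equiv (Quotient.mk_out _) fun _ => Quotient.mk_out _)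

end HammockOp

open HammockOp

variable (P W ι) in
/-- The operad of tree hammocks with planes indexed by `ι`. -/
noncomputable def hammockOperad : SetOperad.{u} where
  Op := HammockOp P W ι
  one := mk Diagram.one
  act := HammockOp.act
  comp := HammockOp.comp
  act_refl c := by
    obtain ⟨t, rfl⟩ := mk_surjective c
    exact congrArg mk (Subtype.ext (HTree.bind_leaf _))
  act_act c σ τ := by
    obtain ⟨t, rfl⟩ := mk_surjective c
    exact congrArg mk (Subtype.ext (HTree.relabel_relabel _ _ _))
  one_comp c := by
    obtain ⟨t, rfl⟩ := mk_surjective c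
    rw [comp_mk, act_mk]
    refine congrArg mk (Subtype.ext ?_)
    rfl
  comp_one c := by
    obtain ⟨t, rfl⟩ := mk_surjective c
    rw [comp_mk, act_mk]
    refine congrArg mk (Subtype.ext ?_)
    rfl
  assoc {_} c {_} d {_} e := by
    obtain ⟨c, rfl⟩ := mk_surjective c
    choose d' hd using fun s => mk_surjective (d s)
    choose e' he using fun s => mk_surjective (e s)
    obtain rfl := funext hd
    obtain rfl := funext he
    simp only [comp_mk, act_mk]
    refine congrArg mk (Subtype.ext ?_)
    simp only [Diagram.comp, Diagram.act, HTree.relabel, HTree.bind_bind, HTree.bind]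
    simp only [← rebracket_apply, Equiv.symm_apply_apply]
  act_comp {_ _} c σ {_} d := by
    obtain ⟨c, rfl⟩ := mk_surjective c
    choose d' hd using fun s => mk_surjective (d s)
    obtain rfl := funext hd
    simp only [comp_mk, act_mk]
    refine congrArg mk (Subtype.ext ?_)
    simp only [Diagram.comp, Diagram.act, HTree.relabel, HTree.bind_bind, HTree.bind]
    congr 1
    funext x
    have key : ∀ s x (_ : σ s = x), ((d' (σ s)).1.bind fun r =>
        (HTree.leaf (finSigmaFinEquiv ⟨s, r⟩) : HTree P W ι _)) =
        (d' x).1.bind fun r => HTree.leaf ((blockPerm σ _).symm (finSigmaFinEquiv ⟨x, r⟩)) := by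
      rintro s _ rfl
      simp only [← blockPerm_apply, Equiv.symm_apply_apply]
    exact key _ _ (σ.apply_symm_apply x)
  comp_act {_} c {_ _} d τ := by
    obtain ⟨c, rfl⟩ := mk_surjective c
    choose d' hd using fun s => mk_surjective (d s)
    obtain rfl := funext hd
    simp only [comp_mk, act_mk]
    refine congrArg mk (Subtype.ext ?_)
    simp only [Diagram.comp, Diagram.act, HTree.relabel, HTree.bind_bind, HTree.bind]
    congr 1
    funext s
    congr 1
    funext x
    obtain ⟨t, rfl⟩ := (τ s).surjective x
    rw [← blockSum_apply, Equiv.symm_apply_apply, Equiv.symm_apply_apply]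

variable (ι) in
/-- Tree hammocks are functorial in the pair `(P, W)` and in the index set of the planes. -/
noncomputable def hammockMap (F : P ⟶ Q) (hF : ∀ f ∈ W.carrier, F.app f ∈ V.carrier)
    (φ : κ →o ι) : hammockOperad P W ι ⟶ hammockOperad Q V κ where
  app := HammockOp.map F hF φ
  map_one := rfl
  map_act c σ := by
    obtain ⟨c, rfl⟩ := mk_surjective c
    exact congrArg mk (Subtype.ext (HTree.map_relabel _ _ _ _ _))
  map_comp {_} c {_} d := by
    obtain ⟨c, rfl⟩ := mk_surjective c
    choose d' hd using fun s => mk_surjective (d s)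
    obtain rfl := funext hd
    change HammockOp.map F hF φ (HammockOp.comp _ _) = HammockOp.comp _ _
    simp only [comp_mk, map_mk]
    refine congrArg mk (Subtype.ext ?_)
    simp only [Diagram.comp, Diagram.map, HTree.map_bind, HTree.map_relabel]

variable (P W ι) in
/-- The canonical map `P → L P`: an operation becomes the tree with one forward pointing piece
which has this label in all planes. -/
noncomputable def incl : P ⟶ hammockOperad P W ι where
  app c := mk (Diagram.corolla c)
  map_one := Quotient.sound <| by
    have := HTree.Rel.fwd_one (W := W) (v := Chain.one P W ι) (t := .leaf (0 : Fin 1)) rfl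
    change HTree.Rel _ (.fwd _ _ fun s => .leaf s) _
    have h : (HTree.leaf : Fin 1 → HTree P W ι (Fin 1)) = fun _ => .leaf 0 :=
      funext fun s => congrArg _ (Subsingleton.elim s 0)
    rwa [show (fun s => HTree.leaf s) = fun _ : Fin 1 => (HTree.leaf 0 : HTree P W ι _) from h]
  map_act c σ := Quotient.sound <| by
    have := HTree.Rel.fwd_act (W := W) (v := Chain.one P W ι) (c := fun _ => c)
      (u := fun _ => Chain.one P W ι) (t := fun s => .leaf (σ.symm s)) σ
      (fun _ _ _ => (P.pre_one c).trans (P.one_post c).symm) fun _ => rfl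
    simp only [Equiv.symm_apply_apply] at this
    exact this
  map_comp {_} c {_} d := by
    refine Eq.trans (Quotient.sound ?_) (comp_mk _ _).symm
    have := HTree.Rel.fwd_comp (W := W) (v := Chain.one P W ι) (c := fun _ => c)
      (u := fun _ => Chain.one P W ι) (d := fun s _ => d s)
      (u' := fun _ _ => Chain.one P W ι) (t := fun s r => .leaf (finSigmaFinEquiv ⟨s, r⟩))
      (fun _ _ _ => (P.pre_one c).trans (P.one_post c).symm)
      (fun s _ _ _ => (P.pre_one (d s)).trans (P.one_post (d s)).symm) fun _ _ => rfl
    simp only [Sigma.eta, Equiv.apply_symm_apply] at this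
    exact this.symm

end

end TreeHammock

/-! ## Simplicial operads -/

/-- Operads in simplicial sets, as simplicial objects in the category of operads in sets
(products of simplicial sets are formed degreewise). -/
abbrev SimplicialOperad := SimplexCategoryᵒᵖ ⥤ SetOperad.{u}

namespace SimplicialOperad

variable (O : SimplicialOperad.{u})

/-- A simplicial submonoid of the simplicial monoid `O(1)`. -/
structure UnarySubmonoid where
  deg : ∀ m : SimplexCategoryᵒᵖ, (O.obj m).UnarySubmonoid
  map_mem : ∀ {m m' : SimplexCategoryᵒᵖ} (φ : m ⟶ m') (f : (O.obj m).Op 1),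
    f ∈ (deg m).carrier → (O.map φ).app f ∈ (deg m').carrier

variable {O}

/-- The tree hammock localization of `O` at `W`, as an operad in simplicial sets: its `m`-simplices
are the tree hammocks of height `m` (with planes `0, …, m`) in the operad of `m`-simplices of `O`.
It is the diagonal of the operad in bisimplicial sets whose `(k, l)`-simplices are the
tree hammocks of height `l` in the operad of `k`-simplices of `O`. -/
noncomputable def localization (W : O.UnarySubmonoid) : SimplicialOperad.{u} where
  obj m := TreeHammock.hammockOperad (O.obj m) (W.deg m) (Fin (m.unop.len + 1))
  map {_ _} φ := TreeHammock.hammockMap _ (O.map φ) (W.map_mem φ) φ.unop.toOrderHom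
  map_id m := by
    refine SetOperad.Hom.ext (funext fun n => funext fun c => ?_)
    obtain ⟨c, rfl⟩ := TreeHammock.HammockOp.mk_surjective c
    exact congrArg TreeHammock.HammockOp.mk (Subtype.ext (TreeHammock.HTree.map_id (O.map_id m) _ _))
  map_comp {m m' m''} φ ψ := by
    refine SetOperad.Hom.ext (funext fun n => funext fun c => ?_)
    obtain ⟨c, rfl⟩ := TreeHammock.HammockOp.mk_surjective c
    exact congrArg TreeHammock.HammockOp.mk (Subtype.ext
      (TreeHammock.HTree.map_map (O.map_comp φ ψ) _ _ _ _ _ _))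

/-- The canonical map of operads from `O` to its localization. -/
noncomputable def toLocalization (W : O.UnarySubmonoid) : O ⟶ localization W where
  app m := TreeHammock.incl (O.obj m) (W.deg m) (Fin (m.unop.len + 1))
  naturality m m' φ := by
    refine SetOperad.Hom.ext (funext fun n => funext fun c => ?_)
    refine congrArg (TreeHammock.HammockOp.mk (ι := Fin (m'.unop.len + 1))) (Subtype.ext ?_)
    simp only [TreeHammock.Diagram.corolla, TreeHammock.Diagram.map, TreeHammock.HTree.map,
      TreeHammock.Chain.map_one]

variable (O)

/-- Algebras over an operad `O` in simplicial sets.  (For a based algebra one asks in addition for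
a vertex of `X` that is the value of a distinguished nullary operation.) -/
structure Algebra where
  X : SSet.{v}
  θ : ∀ {m : SimplexCategoryᵒᵖ} {n : ℕ}, (O.obj m).Op n → (Fin n → X.obj m) → X.obj m
  map_θ : ∀ {m m' : SimplexCategoryᵒᵖ} (φ : m ⟶ m') {n : ℕ} (c : (O.obj m).Op n)
    (x : Fin n → X.obj m), X.map φ (θ c x) = θ ((O.map φ).app c) fun s => X.map φ (x s)
  comp_θ : ∀ {m : SimplexCategoryᵒᵖ} {k : ℕ} (c : (O.obj m).Op k) {j : Fin k → ℕ}
    (d : ∀ s, (O.obj m).Op (j s)) (x : Fin (∑ s, j s) → X.obj m),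
    θ ((O.obj m).comp c d) x = θ c fun s => θ (d s) fun t => x (finSigmaFinEquiv ⟨s, t⟩)
  one_θ : ∀ {m : SimplexCategoryᵒᵖ} (x : X.obj m), θ (O.obj m).one (fun _ => x) = x
  act_θ : ∀ {m : SimplexCategoryᵒᵖ} {n n' : ℕ} (c : (O.obj m).Op n) (σ : Fin n' ≃ Fin n)
    (x : Fin n' → X.obj m), θ ((O.obj m).act c σ) x = θ c fun s => x (σ.symm s)

variable {O}

/-- The map `θ(p; -) : X → X` for a one-ary operation `p`, i.e. a vertex of `O(1)`. -/
def Algebra.unary (Y : O.Algebra) (p : (O.obj (op (.mk 0))).Op 1) : Y.X ⟶ Y.X where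
  app m := ↾fun y => Y.θ ((O.map (SimplexCategory.const m.unop (.mk 0) 0).op).app p) fun _ => y
  naturality m m' φ := by
    ext y
    refine Eq.trans ?_ (Y.map_θ φ _ _).symm
    rw [← SetOperad.comp_app, ← O.map_comp]
    rfl

end SimplicialOperad

/-- Two maps of simplicial sets are homotopic if they are related by the equivalence relation
generated by simplicial homotopies `X × Δ[1] → Y`. -/
def SSet.Homotopic {X Y : SSet.{v}} (f g : X ⟶ Y) : Prop :=
  Relation.EqvGen (fun f g : X ⟶ Y => Nonempty (SSet.Homotopy f g)) f g

/-- Simplicial homotopy equivalences. -/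
def SSet.IsHomotopyEquivalence {X Y : SSet.{v}} (f : X ⟶ Y) : Prop :=
  ∃ g : Y ⟶ X, SSet.Homotopic (f ≫ g) (𝟙 X) ∧ SSet.Homotopic (g ≫ f) (𝟙 Y)

/-! ### The monoid of one-ary operations -/

namespace SetOperad

variable {P : SetOperad.{u}}

/-! The homotopy inverse is the action of the formal inverse of `w`: the vertex of the localization
given by a single backward piece labelled `w` (`Diagram.inv`). Edges of the one-ary part of the
localization act as homotopies on every algebra (`Algebra.homotopic_unary`), so it suffices to join
both composites of `w` and its formal inverse to the identity by edges
(`Algebra.isHomotopyEquivalence_unary`).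

These edges are tree hammocks of height one with two pieces, forward then backward
(`Diagram.zigStep`) or backward then forward (`Diagram.zagStep`). In one plane both pieces carry
`w`, in the other both carry the identity, and the only nontrivial vertical arrow is `w` at the
middle node. The two sides of each square between distinct planes are products of `w` with
identities, so every square commutes. The vertical arrows point from plane 0 to plane 1, which
forces the orientation: the first edge runs from the identity to the composite, the second from the
composite to the identity.

At an end with identity labels, the two pieces are deleted by reduction
(`Diagram.map_zig_equiv_one`, `Diagram.map_zag_equiv_one`). At the other end the tree is already the
graft of the two one-piece trees (`map_zig_eq_post`, `map_zag_eq_post`). Since the localization is a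
diagonal, the labels of an edge have to be 1-simplices; the degenerate edge on `w` is used. -/

lemma post_one (f : P.Op 1) : P.post f P.one = f := by
  rw [post, comp_one, act_act, Subsingleton.elim (Equiv.trans _ _) (Equiv.refl _), act_refl]

/-- The two reindexing bijections agree because they have a one-element target. This turns the
commutativity condition `IsFwd` at a one-ary piece into an identity in the monoid of one-ary
operations. -/
lemma pre_eq_post (f : P.Op 1) (g : Fin 1 → P.Op 1) : P.pre f g = P.post f (g 0) := by
  have h : g = fun _ => g 0 := funext fun s => congrArg g (Subsingleton.elim s 0)
  rw [pre, post, Subsingleton.elim (collapseRight 1) (collapseLeft 1), ← h]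

end SetOperad

/-! ### One-ary tree hammocks with one or two pieces -/

namespace TreeHammock

open SetOperad

variable {P Q : SetOperad.{u}} {W : P.UnarySubmonoid} {V : Q.UnarySubmonoid}

/-- The column of vertical arrows with one arrow `f`, from plane `0` to plane `1`. -/
def Chain.step (f : P.Op 1) (hf : f ∈ W.carrier) : Chain P W (Fin 2) where
  hom {i j} _ := if i = j then P.one else f
  mem {i j} _ := by
    split_ifs
    exacts [W.one_mem, hf]
  hom_refl i := if_pos rfl
  hom_trans {i j l} h h' := by
    by_cases hij : i = j
    · subst hij
      rw [if_pos rfl, one_post]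
    -- With only two planes, a nontrivial arrow can be followed only by an identity.
    · obtain rfl : j = l := by omega
      rw [if_pos rfl, post_one]

/-- With a single plane the only vertical arrows are the reflexive ones. Hence the middle column of
a height-one hammock disappears on passing to an end point. -/
lemma Chain.eq_one {ι : Type} [PartialOrder ι] [Subsingleton ι] (v : Chain P W ι) :
    v = Chain.one P W ι := by
  ext i j h
  obtain rfl := Subsingleton.elim i j
  exact v.hom_refl i

variable {ι : Type} [Preorder ι]

/-- The unary tree hammock `1 → 1 ← 1` with labels `f` and `b`. -/
def Diagram.zig (f b : ι → P.Op 1) (u : Chain P W ι)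
    (hf : IsFwd (Chain.one P W ι) f fun _ : Fin 1 => u) (hb : IsBack u b (Chain.one P W ι)) :
    Diagram P W ι 1 :=
  ⟨.fwd f (fun _ => u) fun _ => .back b (Chain.one P W ι) (.leaf 0),
    ⟨hf, fun _ => ⟨hb, rfl⟩⟩, fun x => by simp [HTree.occ, Subsingleton.elim x 0]⟩

/-- The unary tree hammock `1 ← 1 → 1` with labels `b` and `f`. -/
def Diagram.zag (b f : ι → P.Op 1) (u : Chain P W ι)
    (hb : IsBack (Chain.one P W ι) b u) (hf : IsFwd u f fun _ : Fin 1 => Chain.one P W ι) :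
    Diagram P W ι 1 :=
  ⟨.back b u (.fwd f (fun _ => Chain.one P W ι) fun _ => .leaf 0),
    ⟨hb, hf, fun _ => rfl⟩, fun x => by simp [HTree.occ, Subsingleton.elim x 0]⟩

/-- The tree with one atomic piece `W_1 : 1 ← 1`, labelled `f` in every plane. -/
def Diagram.inv (f : P.Op 1) (hf : f ∈ W.carrier) : Diagram P W ι 1 :=
  ⟨.back (fun _ => f) (Chain.one P W ι) (.leaf 0),
    ⟨⟨fun _ => hf, fun _ _ _ => (post_one f).trans (P.one_post f).symm⟩, rfl⟩,
    fun x => by simp [HTree.occ, Subsingleton.elim x 0]⟩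

end TreeHammock

/-! ### The action of one-ary operations on an algebra -/

namespace SimplicialOperad

variable {O : SimplicialOperad.{u}}

namespace Algebra

variable (Y : Algebra.{u, v} O)

lemma θ_post {m : SimplexCategoryᵒᵖ} (p q : (O.obj m).Op 1) (y : Y.X.obj m) :
    Y.θ ((O.obj m).post p q) (fun _ => y) = Y.θ p fun _ => Y.θ q fun _ => y := by
  rw [SetOperad.post, Y.act_θ, Y.comp_θ]

lemma unary_one : Y.unary (O.obj _).one = 𝟙 Y.X := by
  ext m y
  change Y.θ _ _ = y
  rw [(O.map _).map_one, Y.one_θ]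

lemma unary_post (p q : (O.obj (op (.mk 0))).Op 1) :
    Y.unary ((O.obj _).post p q) = Y.unary q ≫ Y.unary p := by
  ext m y
  change Y.θ _ _ = Y.θ _ fun _ => Y.θ _ _
  rw [SetOperad.map_post, θ_post]

end Algebra
end SimplicialOperad

/-! ### From edges of one-ary operations to homotopies -/

namespace SimplicialOperad

open Simplicial MonoidalCategory SetOperad

variable {O : SimplicialOperad.{u}}

/-- An edge `p` of `O(1)` acts as a homotopy between the actions of its end points. -/
theorem Algebra.homotopic_unary (Y : Algebra.{u, v} O) (p : (O.obj (op (.mk 1))).Op 1) :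
    SSet.Homotopic
      (Y.unary ((O.map (SimplexCategory.const (.mk 0) (.mk 1) 0).op).app p))
      (Y.unary ((O.map (SimplexCategory.const (.mk 0) (.mk 1) 1).op).app p)) := by
  -- A constant map to `[1]` factors through `[0]`, so pulling `p` back along it gives the
  -- degenerate simplex on the `i`-th end point of `p`.
  have key (i : Fin 2) {m : SimplexCategoryᵒᵖ} (y : Y.X.obj m) :
      Y.θ ((O.map (SimplexCategory.const m.unop (.mk 1) i).op).app p) (fun _ => y) =
        (Y.unary ((O.map (SimplexCategory.const (.mk 0) (.mk 1) i).op).app p)).app m y := by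
    change _ = Y.θ _ _
    rw [← SetOperad.comp_app, ← O.map_comp]
    rfl
  refine .rel _ _ ⟨{
    h :=
      -- A simplex of `Δ[1]` is a monotone map `α : [m] → [1]`; on the pair `(y, α)` the homotopy is
      -- the action of `α^* p` on `y`.
      { app m := ↾fun y => Y.θ ((O.map (SSet.stdSimplex.objEquiv y.2).op).app p) fun _ => y.1
        naturality m m' φ := by
          ext y
          refine Eq.trans ?_ (Y.map_θ φ _ _).symm
          rw [← SetOperad.comp_app, ← O.map_comp]
          rfl }
    h₀ := ?_
    h₁ := ?_
    rel := ?_ }⟩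
  · ext m y
    exact key 0 y
  · ext m y
    exact key 1 y
  -- The homotopy is relative to the empty subcomplex, so this condition is vacuous.
  · ext m y
    exact y.1.2.elim

/-- A vertex `p` of `O(1)` acts as a homotopy equivalence if some vertex `q` is inverse to it up to
edges of `O(1)`. -/
theorem Algebra.isHomotopyEquivalence_unary (Y : Algebra.{u, v} O)
    (p q : (O.obj (op (.mk 0))).Op 1)
    (a b : (O.obj (op (.mk 1))).Op 1)
    (ha₀ : (O.map (SimplexCategory.const (.mk 0) (.mk 1) 0).op).app a =
      (O.obj _).post q p)
    (ha₁ : (O.map (SimplexCategory.const (.mk 0) (.mk 1) 1).op).app a =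
      (O.obj _).one)
    (hb₀ : (O.map (SimplexCategory.const (.mk 0) (.mk 1) 0).op).app b =
      (O.obj _).one)
    (hb₁ : (O.map (SimplexCategory.const (.mk 0) (.mk 1) 1).op).app b =
      (O.obj _).post p q) :
    SSet.IsHomotopyEquivalence (Y.unary p) := by
  refine ⟨Y.unary q, ?_, ?_⟩
  · rw [← Y.unary_post, ← Y.unary_one, ← ha₀, ← ha₁]
    exact Y.homotopic_unary a
  · rw [← Y.unary_post, ← Y.unary_one, ← hb₀, ← hb₁]
    -- The edge `b` starts at the identity, so its homotopy is traversed backwards; the generated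
    -- equivalence relation permits this.
    exact (Y.homotopic_unary b).symm

end SimplicialOperad

/-! ### End points of the two connecting edges -/

namespace TreeHammock

open SetOperad HammockOp

variable {P Q : SetOperad.{u}} {W : P.UnarySubmonoid} {V : Q.UnarySubmonoid}
variable {ι κ : Type} [Preorder ι] [PartialOrder κ] [Subsingleton κ]

/-- On a single plane all columns are trivial, so two identity pieces remain: deleting the outer
forward piece and then the inner backward piece leaves a bare leaf. -/
lemma Diagram.map_zig_equiv_one (F : P ⟶ Q) (hF : ∀ f ∈ W.carrier, F.app f ∈ V.carrier)
    (φ : κ →o ι) {f b : ι → P.Op 1} {u : Chain P W ι} (hf) (hb)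
    (hf' : ∀ i, F.app (f (φ i)) = Q.one) (hb' : ∀ i, F.app (b (φ i)) = Q.one) :
    Diagram.map F hF φ (.zig f b u hf hb) ≈ .one := by
  change HTree.Rel _ (.fwd _ _ _) _
  simp only [HTree.map, hf', hb', Chain.eq_one (Chain.map _ _ _ _)]
  have h : HTree.WF (Chain.one Q V κ) (.leaf (0 : Fin 1)) := rfl
  have h' : HTree.WF (Chain.one Q V κ)
      (.back (fun _ => Q.one) (Chain.one Q V κ) (.leaf (0 : Fin 1))) :=
    ⟨⟨fun _ => V.one_mem, fun _ _ _ => rfl⟩, h⟩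
  exact (HTree.Rel.fwd_one h').trans (.back_one h)

lemma Diagram.map_zag_equiv_one (F : P ⟶ Q) (hF : ∀ f ∈ W.carrier, F.app f ∈ V.carrier)
    (φ : κ →o ι) {b f : ι → P.Op 1} {u : Chain P W ι} (hb) (hf)
    (hb' : ∀ i, F.app (b (φ i)) = Q.one) (hf' : ∀ i, F.app (f (φ i)) = Q.one) :
    Diagram.map F hF φ (.zag b f u hb hf) ≈ .one := by
  change HTree.Rel _ (.back _ _ _) _
  simp only [HTree.map, hf', hb', Chain.eq_one (Chain.map _ _ _ _)]
  have h : HTree.WF (Chain.one Q V κ) (.leaf (0 : Fin 1)) := rfl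
  have h' : HTree.WF (Chain.one Q V κ)
      (.fwd (fun _ => Q.one) (fun _ : Fin 1 => Chain.one Q V κ) fun _ => .leaf (0 : Fin 1)) :=
    ⟨fun _ _ _ => (Q.pre_one _).trans (Q.one_post _).symm, fun _ => h⟩
  exact (HTree.Rel.back_one h').trans (.fwd_one h)

/-- No reduction is needed: once `comp_mk` computes the graft on explicit representatives, both
sides are the same tree, a forward piece followed by a backward one. -/
lemma map_zig_eq_post (F : P ⟶ Q) (hF : ∀ f ∈ W.carrier, F.app f ∈ V.carrier)
    (φ : κ →o ι) {f b : ι → P.Op 1} {u : Chain P W ι} (hf) (hb) {w : Q.Op 1} (hw : w ∈ V.carrier)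
    (hf' : ∀ i, F.app (f (φ i)) = w) (hb' : ∀ i, F.app (b (φ i)) = w) :
    HammockOp.map F hF φ (mk (.zig f b u hf hb)) =
      (hammockOperad Q V κ).post ((incl Q V κ).app w) (mk (.inv w hw)) := by
  refine Eq.trans ?_ (congrArg (fun q => HammockOp.act q _) (comp_mk _ _).symm)
  rw [act_mk, map_mk]
  refine congrArg mk (Subtype.ext ?_)
  change HTree.fwd _ _ _ = HTree.fwd _ _ _
  simp only [HTree.map, hf', hb', Chain.eq_one (Chain.map _ _ _ _)]
  -- Only the leaf label can differ, through the relabellings in `post`, and it lies in `Fin 1`.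
  exact congrArg (HTree.fwd _ _) (funext fun s =>
    congrArg (HTree.back _ _) (congrArg HTree.leaf (Subsingleton.elim _ _)))

lemma map_zag_eq_post (F : P ⟶ Q) (hF : ∀ f ∈ W.carrier, F.app f ∈ V.carrier)
    (φ : κ →o ι) {b f : ι → P.Op 1} {u : Chain P W ι} (hb) (hf) {w : Q.Op 1} (hw : w ∈ V.carrier)
    (hb' : ∀ i, F.app (b (φ i)) = w) (hf' : ∀ i, F.app (f (φ i)) = w) :
    HammockOp.map F hF φ (mk (.zag b f u hb hf)) =
      (hammockOperad Q V κ).post (mk (.inv w hw)) ((incl Q V κ).app w) := by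
  refine Eq.trans ?_ (congrArg (fun q => HammockOp.act q _) (comp_mk _ _).symm)
  rw [act_mk, map_mk]
  refine congrArg mk (Subtype.ext ?_)
  change HTree.back _ _ _ = HTree.back _ _ _
  simp only [HTree.map, hf', hb', Chain.eq_one (Chain.map _ _ _ _)]
  exact congrArg (HTree.back _ _) (congrArg (HTree.fwd _ _)
    (funext fun s => congrArg HTree.leaf (Subsingleton.elim _ _)))

/-- The tree hammock of height `1` from the identity to `1 → 1 ← 1` labelled `f`. -/
def Diagram.zigStep (f : P.Op 1) (hf : f ∈ W.carrier) : Diagram P W (Fin 2) 1 :=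
  -- The square of each piece between planes 0 and 1 has both composites equal to `f`: the arrow `f`
  -- at the middle node on one side, the label `f` in plane 1 on the other.
  .zig ![P.one, f] ![P.one, f] (.step f hf)
    (fun i j h => by
      rw [pre_eq_post]
      fin_cases i <;> fin_cases j <;> first
        | exact absurd h (by decide)
        | simp [Chain.step, Chain.one, one_post, post_one])
    ⟨fun i => by fin_cases i; exacts [W.one_mem, hf], fun i j h => by
      fin_cases i <;> fin_cases j <;> first
        | exact absurd h (by decide)
        | simp [Chain.step, Chain.one, one_post, post_one]⟩

/-- The tree hammock of height `1` from `1 ← 1 → 1` labelled `f` to the identity. -/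
def Diagram.zagStep (f : P.Op 1) (hf : f ∈ W.carrier) : Diagram P W (Fin 2) 1 :=
  -- Now the label `f` in plane 0 balances the arrow `f` at the middle node, so the identity labels
  -- belong to plane 1.
  .zag ![f, P.one] ![f, P.one] (.step f hf)
    ⟨fun i => by fin_cases i; exacts [hf, W.one_mem], fun i j h => by
      fin_cases i <;> fin_cases j <;> first
        | exact absurd h (by decide)
        | simp [Chain.step, Chain.one, one_post, post_one]⟩
    (fun i j h => by
      rw [pre_eq_post]
      fin_cases i <;> fin_cases j <;> first
        | exact absurd h (by decide)
        | simp [Chain.step, Chain.one, one_post, post_one])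

end TreeHammock

/-! ### Assembly of the homotopy equivalence -/

open TreeHammock

theorem mainTheorem4 (O : SimplicialOperad.{u}) (W : O.UnarySubmonoid)
    (Y : SimplicialOperad.Algebra.{u, v} (SimplicialOperad.localization W))
    (w : (O.obj (op (.mk 0))).Op 1) (hw : w ∈ (W.deg (op (.mk 0))).carrier) :
    SSet.IsHomotopyEquivalence
      (Y.unary (((SimplicialOperad.toLocalization W).app (op (.mk 0))).app w)) := by
  let s : op (SimplexCategory.mk 0) ⟶ op (SimplexCategory.mk 1) :=
    (SimplexCategory.const (.mk 1) (.mk 0) 0).op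
  -- An edge of the localization is built over the operad of 1-simplices of `O`, so `w` enters
  -- through its degenerate edge, both of whose end points are `w`.
  let w₁ := (O.map s).app w
  have hw₁ : w₁ ∈ (W.deg (op (SimplexCategory.mk 1))).carrier := W.map_mem s w hw
  have hface (i : Fin 2) :
      (O.map (SimplexCategory.const (.mk 0) (.mk 1) i).op).app w₁ = w := by
    change SetOperad.Hom.app _ (SetOperad.Hom.app _ w) = w
    rw [← SetOperad.comp_app, ← O.map_comp, ← op_comp,
      -- The object `[0]` has only one endomorphism.
      show SimplexCategory.const (.mk 0) (.mk 1) i ≫ SimplexCategory.const (.mk 1) (.mk 0) 0 =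
        𝟙 _ from Subsingleton.elim _ _, op_id, O.map_id, SetOperad.id_app]
  -- Vertices are hammocks of height 0 and so have exactly one plane, as the lemmas on end points
  -- require.
  have : Subsingleton (Fin ((op (SimplexCategory.mk 0)).unop.len + 1)) :=
    inferInstanceAs (Subsingleton (Fin 1))
  exact Y.isHomotopyEquivalence_unary _ (HammockOp.mk (Diagram.inv w hw))
    (HammockOp.mk (Diagram.zagStep w₁ hw₁)) (HammockOp.mk (Diagram.zigStep w₁ hw₁))
    (map_zag_eq_post _ _ _ _ _ hw (fun _ => hface 0) fun _ => hface 0)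
    (Quotient.sound (Diagram.map_zag_equiv_one _ _ _ _ _
      (fun _ => (O.map _).map_one) fun _ => (O.map _).map_one))
    (Quotient.sound (Diagram.map_zig_equiv_one _ _ _ _ _
      (fun _ => (O.map _).map_one) fun _ => (O.map _).map_one))
    (map_zig_eq_post _ _ _ _ _ hw (fun _ => hface 1) fun _ => hface 1)
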